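/- **Setting.** Let $\mathcal{E}$ be a set of events, $\mathcal{E}^*$ the set of finite sequences of events, and $\varepsilon\in\mathcal{E}^*$ the empty sequence. Let $\Delta(\mathcal{E}^*)$ be the set of lotteries, i.e. finitely supported probability distributions on $\mathcal{E}^*$; a sequence is identified with its Dirac lottery. For $e\in\mathcal{E}$ and a lottery $p$, $e\cdot p$ is the lottery obtained from $p$ by prepending $e$ to every sequence. Let $\succsim$ be a binary relation on $\Delta(\mathcal{E}^*)$; write $p\succ q$ (or $q\prec p$) for $\neg(q\succsim p)$ and $p\approx q$ for $p\succsim q$ and $q\succsim p$. Fix an outcome $o^\dagger\in\mathcal{E}^*$, and let $\mathcal{O}_{\mathrm{safe}}=\{o\in\mathcal{E}^* : o\not\approx o^\dagger\}$, with $\Delta(\mathcal{O}_{\mathrm{safe}})$ the set of lotteries supported in $\mathcal{O}_{\mathrm{safe}}$. Suppose that the empty sequence is safe, $\varepsilon\in\mathcal{O}_{\mathrm{safe}}$. Let $\mathcal{E}^\dagger=\{e\in\mathcal{E} : e\approx o^\dagger\}$ and $\mathcal{E}_{\mathrm{term}}=\{e\in\mathcal{E} : e\cdot p\approx e\cdot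 q \text{ for all lotteries } p,q\}$. **Assumption 1.** - Completeness: for all lotteries $p,q$, $p\succsim q$ or $q\succsim p$. - Transitivity: $p\succsim q$ and $q\succsim s$ imply $p\succsim s$. - Independence: for all lotteries $p,q,s$ and $\alpha\in[0,1)$, $\alpha p+(1-\alpha)q\succsim\alpha p+(1-\alpha)s \iff q\succsim s$. - Continuity on safe lotteries: for $p,q,s\in\Delta(\mathcal{O}_{\mathrm{safe}})$ with $p\succsim q\succsim s$ there is $\alpha\in[0,1]$ with $\alpha p+(1-\alpha)s\approx q$. - Safety First: for all $p,q\in\Delta(\mathcal{O}_{\mathrm{safe}})$ and $\delta\in(0,1]$, $\delta o^\dagger+(1-\delta)p\prec q$. - Non-triviality: there are $o_1,o_2\in\mathcal{O}_{\mathrm{safe}}$ with $o_1\not\approx o_2$. **Memorylessness.** For every $e\in\mathcal{E}$, either ($e\cdot p\succsim e\cdot q\iff p\succsim q$ for all lotteries $p,q$) or $e\in\mathcal{E}_{\mathrm{term}}$. **Theorem.** The relation $\succsim$ (with $o^\dagger$) satisfies Assumption 1 and Memorylessness if and only if there exist rewards $r:\mathcal{E}\to\mathbb{R}$, multipliers $\gamma:\mathcal{E}\to(0,\infty)$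 and a function $u=(u_1,u_2):\Delta(\mathcal{E}^*)\to\mathbb{R}^2$ such that 1. $u$ is linear, $u(p)=\sum_{o}p(o)u(o)$ for every lottery $p$, and is a lexicographic utility: $u(p)\ge_{\mathrm{lex}}u(q)\iff p\succsim q$ for all lotteries $p,q$; 2. $u(\varepsilon)=(0,0)$ and $u(o^\dagger)=(-1,0)$, and $u$ is not constant on $\mathcal{O}_{\mathrm{safe}}$; 3. for all $e\in\mathcal{E}$ and $\tau\in\mathcal{E}^*$, $$u(e\cdot\tau)=\begin{cases}(0,\,r(e)) & e\in\mathcal{E}_{\mathrm{term}}\setminus\mathcal{E}^\dagger,\\ (-1,\,0) & e\in\mathcal{E}^\dagger,\\ \bigl(u_1(\tau),\ (1+u_1(\tau))\,r(e)+\gamma(e)\,u_2(\tau)\bigr) & \text{otherwise.}\end{cases}$$ -/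

import Mathlib

open Convexity

noncomputable section

namespace LexEUT

/-- Lotteries over a set of outcomes: finitely supported probability distributions. -/
abbrev Lottery (O : Type*) := StdSimplex ℝ O

/-- A (weak) preference relation on lotteries; `R p q` reads `p ≿ q`. -/
abbrev Preference (O : Type*) := Lottery O → Lottery O → Prop

section General

variable {O : Type*}

/-- The Dirac lottery at an outcome. -/
def dirac (o : O) : Lottery O := StdSimplex.single o

/-- The compound lottery `α p + (1 - α) q`, for `α ∈ [0, 1]`. -/
def mix (α : ℝ) (hα : α ∈ Set.Icc (0 : ℝ) 1) (p q : Lottery O) : Lottery O :=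
  convexCombPair α (1 - α) hα.1 (sub_nonneg.2 hα.2) (add_sub_cancel α 1) p q

/-- The set `Δ(S)` of lotteries that only charge outcomes in `S`. -/
def lotteriesOn (S : Set O) : Set (Lottery O) := {p | (p.weights.support : Set O) ⊆ S}

/-- Strict preference: `p ≻ q` means not `q ≿ p`. -/
def Strict (R : Preference O) (p q : Lottery O) : Prop := ¬ R q p

/-- Indifference: `p ≈ q`. -/
def Indiff (R : Preference O) (p q : Lottery O) : Prop := R p q ∧ R q p

def Completeness (R : Preference O) : Prop := ∀ p q, R p q ∨ R q p

def Transitivity (R : Preference O) : Prop := ∀ p q r, R p q → R q r → R p r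

def Independence (R : Preference O) : Prop :=
  ∀ (p q r : Lottery O) (α : ℝ) (hα : α ∈ Set.Icc (0 : ℝ) 1), α < 1 →
    (R (mix α hα p q) (mix α hα p r) ↔ R q r)

/-- Continuity of the relation restricted to a set `D` of lotteries. -/
def ContinuityOn (R : Preference O) (D : Set (Lottery O)) : Prop :=
  ∀ p ∈ D, ∀ q ∈ D, ∀ r ∈ D, R p q → R q r →
    ∃ (α : ℝ) (hα : α ∈ Set.Icc (0 : ℝ) 1), Indiff R (mix α hα p r) q

/-- The safe outcomes: those that are not indifferent to the unsafe outcome `od`. -/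
def safeOutcomes (R : Preference O) (od : O) : Set O :=
  {o | ¬ Indiff R (dirac o) (dirac od)}

/-- Safety First: any positive probability of the unsafe outcome `od`, mixed into any safe
lottery, is strictly worse than every safe lottery. -/
def SafetyFirst (R : Preference O) (od : O) : Prop :=
  ∀ p ∈ lotteriesOn (safeOutcomes R od), ∀ q ∈ lotteriesOn (safeOutcomes R od),
    ∀ (ε : ℝ) (hε : ε ∈ Set.Icc (0 : ℝ) 1), 0 < ε →
      Strict R q (mix ε hε (dirac od) p)

/-- The assumptions for a single unsafe utility, with unsafe outcome `od`. -/
structure SingleUnsafe (R : Preference O) (od : O) : Prop where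
  complete : Completeness R
  trans : Transitivity R
  indep : Independence R
  cont_safe : ContinuityOn R (lotteriesOn (safeOutcomes R od))
  safety : SafetyFirst R od
  nontrivial : ∃ o₁ ∈ safeOutcomes R od, ∃ o₂ ∈ safeOutcomes R od,
    ¬ Indiff R (dirac o₁) (dirac o₂)

/-- A `d`-dimensional lexicographic utility function for `R`; the first coordinate has the
highest priority. -/
def IsLexUtility {d : ℕ} (R : Preference O) (u : Lottery O → Fin d → ℝ) : Prop :=
  ∀ p q, toLex (u p) ≥ toLex (u q) ↔ R p q

/-- Linearity: `u(p) = ∑ₒ p(o) u(o)`. -/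
def IsLinearUtility {d : ℕ} (u : Lottery O → Fin d → ℝ) : Prop :=
  ∀ p, u p = p.weights.sum fun o w => w • u (dirac o)

end General

section Sequential

/- Outcomes are finite sequences of events, i.e. elements of `List E`; the empty sequence is `[]`
and prepending `e` to `τ` gives `e :: τ`. -/
variable {E : Type*}

/-- The concatenation `e · p` of an event and a lottery over sequences. -/
def prepend (e : E) (p : Lottery (List E)) : Lottery (List E) := p.map (List.cons e)

/-- Prepending `e` preserves (and reflects) preferences. -/
def Retains (R : Preference (List E)) (e : E) : Prop :=
  ∀ p q, R (prepend e p) (prepend e q) ↔ R p q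

/-- The terminal events: those that make all continuations indifferent. -/
def terminalEvents (R : Preference (List E)) : Set E :=
  {e | ∀ p q, Indiff R (prepend e p) (prepend e q)}

def Memorylessness (R : Preference (List E)) : Prop :=
  ∀ e, Retains R e ∨ e ∈ terminalEvents R

/-- The unsafe events: those that, as one-term sequences, are indifferent to `od`. -/
def unsafeEvents (R : Preference (List E)) (od : List E) : Set E :=
  {e | Indiff R (dirac [e]) (dirac od)}

/-- The three-case recursion for the utility of `e · τ`; `u · 0` and `u · 1` are the first and
the second coordinate. -/
def SafeRecursion (R : Preference (List E)) (od : List E) (r γ : E → ℝ)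
    (u : Lottery (List E) → Fin 2 → ℝ) : Prop :=
  ∀ (e : E) (τ : List E),
    (e ∈ terminalEvents R \ unsafeEvents R od → u (dirac (e :: τ)) = ![0, r e]) ∧
    (e ∈ unsafeEvents R od → u (dirac (e :: τ)) = ![-1, 0]) ∧
    (e ∉ terminalEvents R ∧ e ∉ unsafeEvents R od →
      u (dirac (e :: τ)) =
        ![u (dirac τ) 0, (1 + u (dirac τ) 0) * r e + γ e * u (dirac τ) 1])

end Sequential

end LexEUT

end

/-!
A preference relation satisfying independence is determined by the convex cone generated by the
differences `p - q` with `p ≿ q`, inside the space of signed measures of mass zero. Modulo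
indifference, continuity on safe lotteries makes the differences of safe outcomes a line, spanned
by some `d`, and Safety First says that `b + t d` is strictly positive for every real `t`, where `b`
is the difference between a safe outcome and the unsafe one. So the cone becomes the lexicographic
half-plane in the frame `(b, d)`, and the coordinates in this frame are the utilities.

Moreover, two lexicographic utilities of one relation differ by an affine map whose linear part is
lower triangular with positive diagonal. If `e` retains preferences, then `p ↦ u (e · p)` is another
such utility; as the first coordinate of an outcome is `0` or `-1`, the affine map must leave it
unchanged and fix the utility `(-1, 0)` of the unsafe outcome, so the only parameters left are `r e`
and `γ e`.
-/

noncomputable section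

namespace LexEUT

section LexOrder

lemma toLex_fin_two_le_iff {α : Type*} [LinearOrder α] {x y : Fin 2 → α} :
    toLex x ≤ toLex y ↔ x 0 < y 0 ∨ (x 0 = y 0 ∧ x 1 ≤ y 1) := by
  have hlt : toLex x < toLex y ↔ x 0 < y 0 ∨ (x 0 = y 0 ∧ x 1 < y 1) := by
    change (∃ i, (∀ j < i, x j = y j) ∧ x i < y i) ↔ _
    simp [Fin.exists_fin_two, Fin.forall_fin_two]
  refine le_iff_lt_or_eq.trans ((or_congr hlt toLex_inj).trans ?_)
  rw [funext_iff, Fin.forall_fin_two, le_iff_lt_or_eq]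
  tauto

lemma toLex_fin_two_nonneg_iff {x : Fin 2 → ℝ} :
    0 ≤ toLex x ↔ 0 < x 0 ∨ (x 0 = 0 ∧ 0 ≤ x 1) := by
  rw [← toLex_zero, toLex_fin_two_le_iff]
  simp only [Pi.zero_apply, eq_comm]

variable {d k : ℕ}

lemma toLex_smul_nonneg {c : ℝ} (hc : 0 ≤ c) {x : Fin d → ℝ} (hx : 0 ≤ toLex x) :
    0 ≤ toLex (c • x) := by
  rcases hc.eq_or_lt with rfl | hc
  · simp
  rcases hx.eq_or_lt with hx | ⟨i, heq, hlt⟩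
  · rw [toLex_smul, ← hx, smul_zero]
  · refine le_of_lt ⟨i, fun j hj => ?_, mul_pos hc hlt⟩
    have hxj : (0 : ℝ) = x j := heq j hj
    change (0 : ℝ) = c * x j
    rw [← hxj, mul_zero]

lemma toLex_smul_nonneg_iff {c : ℝ} (hc : 0 < c) {x : Fin d → ℝ} :
    0 ≤ toLex (c • x) ↔ 0 ≤ toLex x :=
  ⟨fun h => by simpa [smul_smul, hc.ne'] using toLex_smul_nonneg (inv_nonneg.2 hc.le) h,
    toLex_smul_nonneg hc.le⟩

lemma eq_zero_of_toLex_nonneg {x : Fin d → ℝ} (h : 0 ≤ toLex x) (h' : 0 ≤ toLex (-x)) : x = 0 :=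
  toLex.injective (le_antisymm (neg_nonneg.1 h') h)

/-- A linear map that preserves and reflects lexicographic nonnegativity. These are the
transformations that relate the lexicographic utilities of one preference relation. -/
def PreservesLex (A : (Fin d → ℝ) →ₗ[ℝ] (Fin k → ℝ)) : Prop :=
  ∀ x, 0 ≤ toLex (A x) ↔ 0 ≤ toLex x

lemma preservesLex_toLin' {a c g : ℝ} (ha : 0 < a) (hg : 0 < g) :
    PreservesLex (Matrix.toLin' !![a, 0; c, g]) := by
  intro x
  rw [toLex_fin_two_nonneg_iff, toLex_fin_two_nonneg_iff]
  simp only [Matrix.toLin'_apply, Matrix.mulVec, dotProduct, Fin.sum_univ_two, Matrix.of_apply,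
    Matrix.cons_val_zero, Matrix.cons_val_one, zero_mul, add_zero, mul_pos_iff_of_pos_left ha,
    mul_eq_zero, ha.ne', false_or]
  refine or_congr_right (and_congr_right fun h => ?_)
  rw [h, mul_zero, zero_add, mul_nonneg_iff_of_pos_left hg]

lemma PreservesLex.eq_zero {A : (Fin d → ℝ) →ₗ[ℝ] (Fin k → ℝ)} (hA : PreservesLex A)
    {x : Fin d → ℝ} (hx : A x = 0) : x = 0 :=
  eq_zero_of_toLex_nonneg ((hA x).1 (by simp [hx])) ((hA (-x)).1 (by simp [hx]))

lemma PreservesLex.exists_eq_toLin' {A : (Fin 2 → ℝ) →ₗ[ℝ] (Fin 2 → ℝ)} (hA : PreservesLex A) :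
    ∃ a c g : ℝ, 0 < a ∧ 0 < g ∧ A = Matrix.toLin' !![a, 0; c, g] := by
  set x := A ![1, 0] with hx
  set y := A ![0, 1] with hy
  have hA_apply (s t : ℝ) : A ![s, t] = s • x + t • y := by
    rw [hx, hy, ← map_smul, ← map_smul, ← map_add]
    simp
  -- `(1, t)` is positive for every `t`, however negative, so `A (0, 1)` has no first coordinate.
  have hpos (t : ℝ) : 0 ≤ toLex (x + t • y) := by
    rw [← one_smul ℝ x, ← hA_apply, hA, toLex_fin_two_nonneg_iff]
    simp
  have hy0 : y 0 = 0 := by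
    by_contra hne
    have h := toLex_fin_two_nonneg_iff.1 (hpos (-(x 0 + 1) / y 0))
    simp only [Pi.add_apply, Pi.smul_apply, smul_eq_mul, div_mul_cancel₀ _ hne] at h
    rcases h with h | h <;> linarith
  have hy1 : 0 < y 1 := by
    have hnonneg : 0 ≤ toLex y := (hA _).2 (toLex_fin_two_nonneg_iff.2 (by simp))
    have hne : y 1 ≠ 0 := fun h0 => by
      have := congrFun (hA.eq_zero (x := ![0, 1]) (by ext i; fin_cases i <;> assumption)) 1
      simp at this
    have h := toLex_fin_two_nonneg_iff.1 hnonneg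
    simp only [hy0, lt_irrefl, true_and, false_or] at h
    exact h.lt_of_ne' hne
  have hx0 : 0 < x 0 := by
    have h := toLex_fin_two_nonneg_iff.1 (hpos (-(x 1 + 1) / y 1))
    simp only [Pi.add_apply, Pi.smul_apply, smul_eq_mul, hy0, div_mul_cancel₀ _ hy1.ne'] at h
    rcases h with h | h <;> linarith
  refine ⟨x 0, x 1, y 1, hx0, hy1, LinearMap.ext fun z => ?_⟩
  have hz : A z = z 0 • x + z 1 • y := by
    rw [← hA_apply]
    congr 1
    ext i
    fin_cases i <;> rfl
  ext i
  fin_cases i <;> simp [hz, hy0, dotProduct, mul_comm]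

end LexOrder

section Lotteries

variable {O : Type*}

@[simp] lemma weights_dirac (o : O) : (dirac o).weights = Finsupp.single o 1 := rfl

@[simp] lemma weights_mix (α : ℝ) (hα : α ∈ Set.Icc (0 : ℝ) 1) (p q : Lottery O) :
    (mix α hα p q).weights = α • p.weights + (1 - α) • q.weights := by
  simp [mix]

lemma mix_symm (α : ℝ) (hα : α ∈ Set.Icc (0 : ℝ) 1) (p q : Lottery O) :
    mix α hα p q = mix (1 - α) (Set.Icc.mem_iff_one_sub_mem.1 hα) q p := by
  apply StdSimplex.ext
  rw [weights_mix, weights_mix, sub_sub_cancel, add_comm]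

lemma dirac_mem_lotteriesOn {S : Set O} {o : O} (ho : o ∈ S) : dirac o ∈ lotteriesOn S := by
  intro x hx
  obtain rfl : x = o := Finset.mem_singleton.1 (Finsupp.support_single_subset hx)
  exact ho

lemma isConvexSet_lotteriesOn (S : Set O) : IsConvexSet ℝ (lotteriesOn S) := by
  classical
  refine .of_convexCombPair_mem fun α β hα hβ hαβ p hp q hq o ho => ?_
  by_contra hS
  have hpo : p.weights o = 0 := by simpa using fun h => hS (hp h)
  have hqo : q.weights o = 0 := by simpa using fun h => hS (hq h)
  simp [hpo, hqo] at ho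

lemma mix_mem {D : Set (Lottery O)} (hD : IsConvexSet ℝ D) {α : ℝ} (hα : α ∈ Set.Icc (0 : ℝ) 1)
    {p q : Lottery O} (hp : p ∈ D) (hq : q ∈ D) : mix α hα p q ∈ D :=
  hD.convexCombPair_mem hp hq _ _ _

/-- The total mass of a finitely supported signed measure. The signed measures of mass zero are
the multiples of differences of lotteries. -/
def mass : (O →₀ ℝ) →ₗ[ℝ] ℝ := Finsupp.linearCombination ℝ fun _ => 1

@[simp] lemma mass_weights (p : Lottery O) : mass p.weights = 1 := by
  rw [mass, Finsupp.linearCombination_apply]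
  simp

lemma exists_eq_mass_smul_weights [Nonempty O] {v : O →₀ ℝ} (hv : 0 ≤ v) :
    ∃ p : Lottery O, v = mass v • p.weights := by
  have hmass : mass v = ∑ o ∈ v.support, v o := by
    simp [mass, Finsupp.linearCombination_apply, Finsupp.sum]
  rcases (Finset.sum_nonneg fun o _ => hv o : 0 ≤ ∑ o ∈ v.support, v o).eq_or_lt with h | h
  · have hv0 : v = 0 := by
      ext o
      by_contra hne
      exact hne ((Finset.sum_eq_zero_iff_of_nonneg fun o _ => hv o).1 h.symm o
        (Finsupp.mem_support_iff.2 hne))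
    obtain ⟨o⟩ := ‹Nonempty O›
    exact ⟨dirac o, by simp [hv0]⟩
  · rw [← hmass] at h
    refine ⟨⟨(mass v)⁻¹ • v, fun o => mul_nonneg (inv_nonneg.2 h.le) (hv o), ?_⟩, ?_⟩
    · rw [Finsupp.sum_smul_index' (fun _ => rfl), ← Finsupp.smul_sum, Finsupp.sum, ← hmass]
      exact inv_mul_cancel₀ h.ne'
    · exact (smul_inv_smul₀ h.ne' v).symm

lemma exists_eq_smul_weights_sub_weights [Nonempty O] {v : O →₀ ℝ} (hv : mass v = 0) :
    ∃ (c : ℝ) (p q : Lottery O), 0 ≤ c ∧ v = c • (p.weights - q.weights) := by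
  obtain ⟨p, hp⟩ := exists_eq_mass_smul_weights (posPart_nonneg v)
  obtain ⟨q, hq⟩ := exists_eq_mass_smul_weights (negPart_nonneg v)
  have hmass : mass v⁺ = mass v⁻ := by
    rw [← sub_eq_zero, ← map_sub, posPart_sub_negPart, hv]
  refine ⟨mass v⁺, p, q, ?_, ?_⟩
  · rw [mass, Finsupp.linearCombination_apply]
    exact Finset.sum_nonneg fun o _ => mul_nonneg (posPart_nonneg v o) zero_le_one
  · rw [smul_sub, ← hp, hmass, ← hq, posPart_sub_negPart]

lemma linearCombination_weights_affine {V W : Type*} [AddCommGroup V] [Module ℝ V]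
    [AddCommGroup W] [Module ℝ W] (A : V →ₗ[ℝ] W) (b : W) (x : O → V) (p : Lottery O) :
    Finsupp.linearCombination ℝ (fun o => A (x o) + b) p.weights =
      A (Finsupp.linearCombination ℝ x p.weights) + b := by
  have hconst : (p.weights.sum fun _ a => a • b) = b := by
    rw [Finsupp.sum, ← Finset.sum_smul, show ∑ o ∈ p.weights.support, p.weights o = 1 from p.total,
      one_smul]
  rw [Finsupp.apply_linearCombination, Finsupp.linearCombination_apply,
    Finsupp.linearCombination_apply]
  simp only [smul_add, Function.comp_apply]
  rw [Finsupp.sum_add, hconst]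

end Lotteries

section LinearUtility

variable {O : Type*} {d k : ℕ} {u : Lottery O → Fin d → ℝ}

lemma IsLinearUtility.eq_linearCombination (hu : IsLinearUtility u) (p : Lottery O) :
    u p = Finsupp.linearCombination ℝ (fun o => u (dirac o)) p.weights :=
  hu p

lemma IsLinearUtility.map_mix (hu : IsLinearUtility u) (α : ℝ) (hα : α ∈ Set.Icc (0 : ℝ) 1)
    (p q : Lottery O) : u (mix α hα p q) = α • u p + (1 - α) • u q := by
  rw [hu.eq_linearCombination, weights_mix, map_add, map_smul, map_smul,
    ← hu.eq_linearCombination, ← hu.eq_linearCombination]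

lemma isLinearUtility_linearCombination (x : O → Fin d → ℝ) :
    IsLinearUtility fun p => Finsupp.linearCombination ℝ x p.weights := by
  intro p
  simp only [weights_dirac, Finsupp.linearCombination_single, one_smul]
  rfl

lemma IsLinearUtility.affine (hu : IsLinearUtility u) (A : (Fin d → ℝ) →ₗ[ℝ] (Fin k → ℝ))
    (b : Fin k → ℝ) : IsLinearUtility fun p => A (u p) + b := by
  intro p
  simp only [hu.eq_linearCombination p]
  exact (linearCombination_weights_affine A b _ p).symm

lemma IsLinearUtility.ext {w : Lottery O → Fin d → ℝ} (hu : IsLinearUtility u)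
    (hw : IsLinearUtility w) (h : ∀ o, u (dirac o) = w (dirac o)) : u = w := by
  funext p
  rw [hu p, hw p]
  simp only [h]

lemma IsLinearUtility.apply_eq_of_mem_lotteriesOn (hu : IsLinearUtility u) {S : Set O} {i : Fin d}
    {a : ℝ} (h : ∀ o ∈ S, u (dirac o) i = a) {p : Lottery O} (hp : p ∈ lotteriesOn S) :
    u p i = a := by
  rw [hu p, Finsupp.sum, Finset.sum_apply, ← one_mul a,
    ← show ∑ o ∈ p.weights.support, p.weights o = 1 from p.total, Finset.sum_mul]
  exact Finset.sum_congr rfl fun o ho => by rw [Pi.smul_apply, smul_eq_mul, h o (hp ho)]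

end LinearUtility

section IndependentWeakOrder

variable {O : Type*} {R : Preference O} {d : ℕ}

/-- The weak orders on lotteries that satisfy independence: the relations for which the von
Neumann–Morgenstern axioms hold except for continuity. -/
structure IndependentWeakOrder (R : Preference O) : Prop where
  complete : Completeness R
  trans : Transitivity R
  indep : Independence R

lemma Completeness.refl (hc : Completeness R) (p : Lottery O) : R p p := (hc p p).elim id id

lemma Independence.mix_left_iff (hi : Independence R) {α : ℝ} (hα : α ∈ Set.Icc (0 : ℝ) 1)
    (h0 : 0 < α) (p q s : Lottery O) : R (mix α hα p s) (mix α hα q s) ↔ R p q := by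
  rw [mix_symm α hα p s, mix_symm α hα q s]
  exact hi _ _ _ _ _ (sub_lt_self 1 h0)

lemma IndependentWeakOrder.mix_mono_right (hR : IndependentWeakOrder R) {α : ℝ}
    (hα : α ∈ Set.Icc (0 : ℝ) 1) (s : Lottery O) {p q : Lottery O} (h : R p q) :
    R (mix α hα s p) (mix α hα s q) := by
  rcases hα.2.eq_or_lt with rfl | h1
  · have hmix : mix 1 hα s p = mix 1 hα s q := StdSimplex.ext (by simp)
    exact hmix ▸ hR.complete.refl _
  · exact (hR.indep s p q α hα h1).2 h

lemma IndependentWeakOrder.mix_mono (hR : IndependentWeakOrder R) {α : ℝ}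
    (hα : α ∈ Set.Icc (0 : ℝ) 1) {p q p' q' : Lottery O} (h : R p q) (h' : R p' q') :
    R (mix α hα p p') (mix α hα q q') := by
  refine hR.trans _ (mix α hα p q') _ (hR.mix_mono_right hα p h') ?_
  rw [mix_symm α hα p, mix_symm α hα q]
  exact hR.mix_mono_right _ q' h

lemma isLexUtility_iff_sub_nonneg {u : Lottery O → Fin d → ℝ} :
    IsLexUtility R u ↔ ∀ p q, 0 ≤ toLex (u p - u q) ↔ R p q := by
  simp only [IsLexUtility, toLex_sub, sub_nonneg, ge_iff_le]

lemma IsLexUtility.indiff_iff {u : Lottery O → Fin d → ℝ} (hu : IsLexUtility R u)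
    {p q : Lottery O} : Indiff R p q ↔ u p = u q := by
  rw [Indiff, ← hu, ← hu, ge_iff_le, ge_iff_le, ← le_antisymm_iff, toLex_inj, eq_comm]

lemma IsLexUtility.independentWeakOrder {u : Lottery O → Fin d → ℝ} (hu : IsLexUtility R u)
    (hlin : IsLinearUtility u) : IndependentWeakOrder R where
  complete p q := by
    rw [← hu, ← hu]
    exact le_total _ _
  trans p q s := by
    rw [← hu, ← hu, ← hu]
    exact fun h h' => h'.trans h
  indep p q s α hα h1 := by
    rw [isLexUtility_iff_sub_nonneg] at hu
    rw [← hu, ← hu, hlin.map_mix, hlin.map_mix, add_sub_add_left_eq_sub, ← smul_sub,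
      toLex_smul_nonneg_iff (sub_pos.2 h1)]

end IndependentWeakOrder

section Uniqueness

variable {O : Type*} [Nonempty O] {R : Preference O} {d k : ℕ}
  {u : Lottery O → Fin d → ℝ} {w : Lottery O → Fin k → ℝ}

lemma IsLexUtility.nonneg_linearCombination_iff (hu : IsLexUtility R u)
    (hu_lin : IsLinearUtility u) (hw : IsLexUtility R w) (hw_lin : IsLinearUtility w)
    {v : O →₀ ℝ} (hv : mass v = 0) :
    0 ≤ toLex (Finsupp.linearCombination ℝ (fun o => w (dirac o)) v) ↔
      0 ≤ toLex (Finsupp.linearCombination ℝ (fun o => u (dirac o)) v) := by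
  obtain ⟨c, p, q, hc, rfl⟩ := exists_eq_smul_weights_sub_weights hv
  simp only [map_smul, map_sub, ← hu_lin.eq_linearCombination, ← hw_lin.eq_linearCombination]
  rcases hc.eq_or_lt with rfl | hc
  · simp
  · rw [toLex_smul_nonneg_iff hc, toLex_smul_nonneg_iff hc, isLexUtility_iff_sub_nonneg.1 hw,
      isLexUtility_iff_sub_nonneg.1 hu]

theorem IsLexUtility.exists_preservesLex (hu : IsLexUtility R u) (hu_lin : IsLinearUtility u)
    (hspan : vectorSpan ℝ (Set.range fun o => u (dirac o)) = ⊤)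
    (hw : IsLexUtility R w) (hw_lin : IsLinearUtility w) :
    ∃ A : (Fin d → ℝ) →ₗ[ℝ] (Fin k → ℝ), PreservesLex A ∧ ∀ p q, w p - w q = A (u p - u q) := by
  set U := Finsupp.linearCombination ℝ fun o => u (dirac o)
  set W := Finsupp.linearCombination ℝ fun o => w (dirac o)
  have hUW (v : O →₀ ℝ) (hv : mass v = 0) : 0 ≤ toLex (W v) ↔ 0 ≤ toLex (U v) :=
    hu.nonneg_linearCombination_iff hu_lin hw hw_lin hv
  have hker (v : O →₀ ℝ) (hv : mass v = 0) (hUv : U v = 0) : W v = 0 :=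
    eq_zero_of_toLex_nonneg ((hUW v hv).2 (by simp [hUv]))
      (by rw [← map_neg, hUW _ (by simp [hv])]; simp [hUv])
  have hsurj : LinearMap.range (U.domRestrict (LinearMap.ker mass)) = ⊤ := by
    rw [eq_top_iff, ← hspan, vectorSpan, Submodule.span_le]
    rintro _ ⟨_, ⟨o, rfl⟩, _, ⟨o', rfl⟩, rfl⟩
    refine ⟨⟨(dirac o).weights - (dirac o').weights, ?_⟩, ?_⟩
    · rw [LinearMap.mem_ker, map_sub, mass_weights, mass_weights, sub_self]
    · simp [U]
  obtain ⟨S, hS⟩ := LinearMap.exists_rightInverse_of_surjective _ hsurj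
  have hUS (x : Fin d → ℝ) : U (S x) = x := LinearMap.congr_fun hS x
  refine ⟨W ∘ₗ (LinearMap.ker mass).subtype ∘ₗ S, fun x => ?_, fun p q => ?_⟩
  · rw [← hUS x]
    exact (hUW _ (S _).2).trans (by rw [hUS, hUS])
  · have h := hker (p.weights - q.weights - S (u p - u q)) (by simp [LinearMap.mem_ker.1 (S _).2])
      (by rw [map_sub, hUS, map_sub, ← hu_lin.eq_linearCombination, ← hu_lin.eq_linearCombination,
        sub_self])
    rw [map_sub, map_sub, ← hw_lin.eq_linearCombination, ← hw_lin.eq_linearCombination] at h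
    exact sub_eq_zero.1 h

end Uniqueness

section PreferenceCone

variable {O : Type*} {R : Preference O}

/-- The cone of signed measures generated by the differences `p - q` with `p ≿ q`. By independence
it determines the preference relation, see `sub_mem_prefCone_iff`; its lineality space collects
the directions of indifference. -/
def prefCone (R : Preference O) : PointedCone ℝ (O →₀ ℝ) :=
  PointedCone.hull ℝ {v | ∃ p q : Lottery O, R p q ∧ v = p.weights - q.weights}

lemma sub_mem_prefCone {p q : Lottery O} (h : R p q) : p.weights - q.weights ∈ prefCone R :=
  PointedCone.subset_hull ⟨p, q, h, rfl⟩

lemma Indiff.sub_mem_lineal {p q : Lottery O} (h : Indiff R p q) :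
    p.weights - q.weights ∈ (prefCone R).lineal :=
  PointedCone.mem_lineal.2
    ⟨sub_mem_prefCone h.1, (neg_sub p.weights q.weights).symm ▸ sub_mem_prefCone h.2⟩

lemma IndependentWeakOrder.mem_prefCone_iff [Nonempty O] (hR : IndependentWeakOrder R)
    {v : O →₀ ℝ} :
    v ∈ prefCone R ↔
      ∃ (c : ℝ) (p q : Lottery O), 0 ≤ c ∧ R p q ∧ v = c • (p.weights - q.weights) := by
  constructor
  · intro hv
    induction hv using Submodule.span_induction with
    | mem v hv =>
      obtain ⟨p, q, h, rfl⟩ := hv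
      exact ⟨1, p, q, zero_le_one, h, (one_smul ℝ _).symm⟩
    | zero =>
      obtain ⟨o⟩ := ‹Nonempty O›
      exact ⟨0, dirac o, dirac o, le_rfl, hR.complete.refl _, (zero_smul ℝ _).symm⟩
    | smul a v _ hv =>
      obtain ⟨c, p, q, hc, h, rfl⟩ := hv
      exact ⟨a * c, p, q, mul_nonneg a.2 hc, h, smul_smul (a : ℝ) c _⟩
    | add v v' _ _ hv hv' =>
      obtain ⟨c, p, q, hc, h, rfl⟩ := hv
      obtain ⟨c', p', q', hc', h', rfl⟩ := hv'
      have hα : c / (c + c') ∈ Set.Icc (0 : ℝ) 1 :=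
        ⟨by positivity, div_le_one_of_le₀ (by linarith) (by positivity)⟩
      have hmul : (c + c') * (c / (c + c')) = c :=
        mul_div_cancel_of_imp' fun h0 => by linarith
      refine ⟨c + c', mix _ hα p p', mix _ hα q q', by positivity, hR.mix_mono hα h h', ?_⟩
      rw [weights_mix, weights_mix, add_sub_add_comm, ← smul_sub, ← smul_sub, smul_add,
        smul_smul, smul_smul, mul_sub, hmul, mul_one, add_sub_cancel_left]
  · rintro ⟨c, p, q, hc, h, rfl⟩
    exact PointedCone.smul_mem _ hc (sub_mem_prefCone h)

lemma IndependentWeakOrder.sub_mem_prefCone_iff (hR : IndependentWeakOrder R) {p q : Lottery O} :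
    p.weights - q.weights ∈ prefCone R ↔ R p q := by
  refine ⟨fun h => ?_, sub_mem_prefCone⟩
  have : Nonempty O := p.nonempty
  obtain ⟨c, p', q', hc, h', heq⟩ := hR.mem_prefCone_iff.1 h
  have hpos : 0 < 1 / (1 + c) := by positivity
  have hα : 1 / (1 + c) ∈ Set.Icc (0 : ℝ) 1 :=
    ⟨hpos.le, (div_le_one (by positivity)).2 (by linarith)⟩
  have hmix : mix _ hα q p' = mix _ hα p q' := by
    apply StdSimplex.ext
    rw [weights_mix, weights_mix, ← sub_add_cancel p.weights q.weights, heq,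
      show 1 - 1 / (1 + c) = 1 / (1 + c) * c by field_simp; ring]
    module
  exact (hR.indep.mix_left_iff hα hpos p q q').1 (hmix ▸ hR.mix_mono_right hα q h')

lemma IndependentWeakOrder.mem_or_neg_mem_prefCone [Nonempty O] (hR : IndependentWeakOrder R)
    {v : O →₀ ℝ} (hv : mass v = 0) : v ∈ prefCone R ∨ -v ∈ prefCone R := by
  obtain ⟨c, p, q, hc, rfl⟩ := exists_eq_smul_weights_sub_weights hv
  refine (hR.complete p q).imp (fun h => PointedCone.smul_mem _ hc (sub_mem_prefCone h)) fun h => ?_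
  rw [← smul_neg, neg_sub]
  exact PointedCone.smul_mem _ hc (sub_mem_prefCone h)

lemma mem_iff_mem_of_sub_mem_lineal {M : Type*} [AddCommGroup M] [Module ℝ M]
    {C : PointedCone ℝ M} {v w : M} (h : v - w ∈ C.lineal) : v ∈ C ↔ w ∈ C := by
  refine ⟨fun hv => ?_, fun hw => ?_⟩
  · simpa using add_mem hv h.2
  · simpa using add_mem hw h.1

lemma smul_mem_iff_nonneg {M : Type*} [AddCommGroup M] [Module ℝ M] {C : PointedCone ℝ M}
    {v : M} (hv : v ∈ C) (hv' : -v ∉ C) {s : ℝ} : s • v ∈ C ↔ 0 ≤ s := by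
  refine ⟨fun h => ?_, fun h => C.smul_mem h hv⟩
  by_contra! hs
  rw [← neg_smul_neg] at h
  exact hv' ((C.smul_mem_iff (neg_pos.2 hs)).1 h)

lemma linearCombination_mem_iff_toLex_nonneg {M : Type*} [AddCommGroup M] [Module ℝ M]
    {C : PointedCone ℝ M} {b d : M} (hd : d ∈ C) (hd' : -d ∉ C)
    (hb : ∀ t : ℝ, b + t • d ∈ C ∧ -(b + t • d) ∉ C) (x : Fin 2 → ℝ) :
    Fintype.linearCombination ℝ ![b, d] x ∈ C ↔ 0 ≤ toLex x := by
  rw [toLex_fin_two_nonneg_iff, Fintype.linearCombination_apply, Fin.sum_univ_two]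
  change x 0 • b + x 1 • d ∈ C ↔ _
  by_cases h0 : x 0 = 0
  · simp [h0, smul_mem_iff_nonneg hd hd']
  · have hfactor : x 0 • b + x 1 • d = x 0 • (b + (x 1 / x 0) • d) := by
      rw [smul_add, smul_smul, mul_div_cancel₀ _ h0]
    rw [hfactor, smul_mem_iff_nonneg (hb _).1 (hb _).2, (Ne.symm h0).le_iff_lt]
    simp [h0]

theorem IndependentWeakOrder.exists_isLexUtility_of_frame (hR : IndependentWeakOrder R) {d : ℕ}
    {c : (Fin d → ℝ) →ₗ[ℝ] (O →₀ ℝ)} (hc : ∀ x, c x ∈ prefCone R ↔ 0 ≤ toLex x) {o₀ : O}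
    {x : O → Fin d → ℝ}
    (hx : ∀ o, (dirac o).weights - (dirac o₀).weights - c (x o) ∈ (prefCone R).lineal) :
    ∃ u : Lottery O → Fin d → ℝ,
      IsLinearUtility u ∧ IsLexUtility R u ∧ ∀ o, u (dirac o) = x o := by
  set X := Finsupp.linearCombination ℝ x
  have hcoord (p : Lottery O) :
      p.weights - (dirac o₀).weights - c (X p.weights) ∈ (prefCone R).lineal := by
    have haff := linearCombination_weights_affine (LinearMap.id - c ∘ₗ X) (-(dirac o₀).weights)
      (fun o => (dirac o).weights) p
    have hp : Finsupp.linearCombination ℝ (fun o => (dirac o).weights) p.weights = p.weights := by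
      simp [Finsupp.linearCombination_apply]
    rw [hp, Finsupp.linearCombination_apply] at haff
    rw [sub_right_comm, sub_eq_add_neg _ (dirac o₀).weights]
    refine haff ▸ Submodule.sum_mem _ fun o _ => Submodule.smul_mem _ _ ?_
    convert hx o using 1
    simp only [X, LinearMap.sub_apply, LinearMap.id_apply, LinearMap.comp_apply, weights_dirac,
      Finsupp.linearCombination_single, one_smul]
    abel
  refine ⟨fun p => X p.weights, isLinearUtility_linearCombination x,
    isLexUtility_iff_sub_nonneg.2 fun p q => ?_, fun o => by simp [X]⟩
  rw [← hc, ← hR.sub_mem_prefCone_iff, map_sub]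
  refine (mem_iff_mem_of_sub_mem_lineal ?_).symm
  convert sub_mem (hcoord p) (hcoord q) using 1
  abel

end PreferenceCone

section Calibration

variable {O : Type*} {R : Preference O} {D : Set (Lottery O)} {a b p q : Lottery O}

lemma IndependentWeakOrder.exists_smul_sub_sub_mem_lineal (hR : IndependentWeakOrder R)
    (hcont : ContinuityOn R D) (hD : IsConvexSet ℝ D) (ha : a ∈ D) (hb : b ∈ D) (hp : p ∈ D)
    (hq : q ∈ D) (hpq : R p q)
    (h : (a.weights - b.weights) - (p.weights - q.weights) ∈ prefCone R) :
    ∃ α : ℝ, α • (a.weights - b.weights) - (p.weights - q.weights) ∈ (prefCone R).lineal := by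
  have hhalf : (1 / 2 : ℝ) ∈ Set.Icc (0 : ℝ) 1 := by norm_num
  have haq_bp : R (mix _ hhalf a q) (mix _ hhalf b p) := by
    rw [← hR.sub_mem_prefCone_iff]
    convert PointedCone.smul_mem _ hhalf.1 h using 1
    simp only [weights_mix]
    module
  obtain ⟨α, hα, hind⟩ := hcont _ (mix_mem hD hhalf ha hq) _ (mix_mem hD hhalf hb hp) _
    (mix_mem hD hhalf hb hq) haq_bp (hR.mix_mono_right hhalf b hpq)
  refine ⟨α, ?_⟩
  convert Submodule.smul_mem _ (2 : ℝ) hind.sub_mem_lineal using 1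
  simp only [weights_mix]
  module

theorem IndependentWeakOrder.exists_sub_smul_sub_mem_lineal (hR : IndependentWeakOrder R)
    (hcont : ContinuityOn R D) (hD : IsConvexSet ℝ D) (ha : a ∈ D) (hb : b ∈ D) (hp : p ∈ D)
    (hq : q ∈ D) (hqp : ¬ R q p) :
    ∃ t : ℝ, (a.weights - b.weights) - t • (p.weights - q.weights) ∈ (prefCone R).lineal := by
  wlog hab : R a b generalizing a b
  · obtain ⟨t, ht⟩ := this hb ha ((hR.complete a b).resolve_left hab)
    refine ⟨-t, ?_⟩
    convert neg_mem ht using 1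
    module
  have hpq : R p q := (hR.complete p q).resolve_right hqp
  have : Nonempty O := p.nonempty
  rcases hR.mem_or_neg_mem_prefCone
      (v := (a.weights - b.weights) - (p.weights - q.weights)) (by simp) with h | h
  · obtain ⟨α, hα⟩ := hR.exists_smul_sub_sub_mem_lineal hcont hD ha hb hp hq hpq h
    have hα0 : α ≠ 0 := by
      rintro rfl
      rw [zero_smul, zero_sub, neg_sub] at hα
      exact hqp (hR.sub_mem_prefCone_iff.1 hα.1)
    refine ⟨α⁻¹, ?_⟩
    convert Submodule.smul_mem _ α⁻¹ hα using 1
    rw [smul_sub α⁻¹ (α • _), inv_smul_smul₀ hα0]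
  · rw [neg_sub] at h
    obtain ⟨α, hα⟩ := hR.exists_smul_sub_sub_mem_lineal hcont hD hp hq ha hb hab h
    exact ⟨α, neg_sub (α • (p.weights - q.weights)) _ ▸ neg_mem hα⟩

end Calibration

section SafetyUtility

variable {O : Type*} {R : Preference O} {od : O} {u : Lottery O → Fin 2 → ℝ}

/-- The normalized utilities of a preference relation with a single unsafe outcome `od`: the first
coordinate is minus the probability of an unsafe outcome, and the second one represents the
preferences among safe lotteries. -/
structure IsSafetyUtility (R : Preference O) (od : O) (u : Lottery O → Fin 2 → ℝ) : Prop where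
  linear : IsLinearUtility u
  lex : IsLexUtility R u
  map_od : u (dirac od) = ![-1, 0]
  map_safe : ∀ o ∈ safeOutcomes R od, u (dirac o) 0 = 0

lemma SingleUnsafe.independentWeakOrder (h : SingleUnsafe R od) : IndependentWeakOrder R :=
  ⟨h.complete, h.trans, h.indep⟩

lemma SingleUnsafe.exists_not_rel (h : SingleUnsafe R od) :
    ∃ o₁ ∈ safeOutcomes R od, ∃ o₂ ∈ safeOutcomes R od, ¬ R (dirac o₂) (dirac o₁) := by
  obtain ⟨o₁, h₁, o₂, h₂, hne⟩ := h.nontrivial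
  by_cases h21 : R (dirac o₂) (dirac o₁)
  · exact ⟨o₂, h₂, o₁, h₁, fun h12 => hne ⟨h12, h21⟩⟩
  · exact ⟨o₁, h₁, o₂, h₂, h21⟩

lemma SafetyFirst.sub_add_smul_sub_mem_prefCone (hs : SafetyFirst R od)
    (hR : IndependentWeakOrder R) {a b c : O} (ha : a ∈ safeOutcomes R od)
    (hb : b ∈ safeOutcomes R od) (hc : c ∈ safeOutcomes R od) (t : ℝ) :
    ((dirac a).weights - (dirac od).weights) + t • ((dirac b).weights - (dirac c).weights) ∈
        prefCone R ∧
      -(((dirac a).weights - (dirac od).weights) +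
        t • ((dirac b).weights - (dirac c).weights)) ∉ prefCone R := by
  wlog ht : 0 ≤ t generalizing b c t
  · have hswap := this hc hb (-t) (by linarith)
    rwa [neg_smul, ← smul_neg, neg_sub] at hswap
  have hpos : 0 < 1 / (1 + t) := by positivity
  have hα : 1 / (1 + t) ∈ Set.Icc (0 : ℝ) 1 :=
    ⟨hpos.le, (div_le_one (by positivity)).2 (by linarith)⟩
  have hstrict : ¬ R (mix _ hα (dirac od) (dirac c)) (mix _ hα (dirac a) (dirac b)) :=
    hs _ (dirac_mem_lotteriesOn hc) _ (mix_mem (isConvexSet_lotteriesOn _) hα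
      (dirac_mem_lotteriesOn ha) (dirac_mem_lotteriesOn hb)) _ hα hpos
  have hdiff : (mix _ hα (dirac a) (dirac b)).weights - (mix _ hα (dirac od) (dirac c)).weights =
      (1 / (1 + t)) • (((dirac a).weights - (dirac od).weights) +
        t • ((dirac b).weights - (dirac c).weights)) := by
    rw [weights_mix, weights_mix, show 1 - 1 / (1 + t) = 1 / (1 + t) * t by field_simp; ring]
    module
  rw [← (prefCone R).smul_mem_iff hpos, ← (prefCone R).smul_mem_iff hpos (x := -_), smul_neg,
    ← hdiff, neg_sub, hR.sub_mem_prefCone_iff, hR.sub_mem_prefCone_iff]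
  exact ⟨(hR.complete _ _).resolve_right hstrict, hstrict⟩

lemma SingleUnsafe.exists_coord (h : SingleUnsafe R od) {o₀ o₁ o₂ : O}
    (h₀ : o₀ ∈ safeOutcomes R od) (h₁ : o₁ ∈ safeOutcomes R od) (h₂ : o₂ ∈ safeOutcomes R od)
    (h21 : ¬ R (dirac o₂) (dirac o₁)) (o : O) :
    ∃ x : Fin 2 → ℝ, (o ∈ safeOutcomes R od → x 0 = 0) ∧
      (o ∉ safeOutcomes R od → x = ![-1, 0]) ∧
      (dirac o).weights - (dirac o₀).weights - Fintype.linearCombination ℝ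
        ![(dirac o₀).weights - (dirac od).weights, (dirac o₁).weights - (dirac o₂).weights] x ∈
          (prefCone R).lineal := by
  by_cases ho : o ∈ safeOutcomes R od
  · obtain ⟨t, ht⟩ := h.independentWeakOrder.exists_sub_smul_sub_mem_lineal h.cont_safe
      (isConvexSet_lotteriesOn _) (dirac_mem_lotteriesOn ho) (dirac_mem_lotteriesOn h₀)
      (dirac_mem_lotteriesOn h₁) (dirac_mem_lotteriesOn h₂) h21
    exact ⟨![0, t], fun _ => rfl, fun ho' => absurd ho ho',
      by simpa [Fintype.linearCombination_apply] using ht⟩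
  · refine ⟨![-1, 0], fun ho' => absurd ho' ho, fun _ => rfl, ?_⟩
    convert (not_not.1 ho : Indiff R (dirac o) (dirac od)).sub_mem_lineal using 1
    simp [Fintype.linearCombination_apply]

theorem SingleUnsafe.exists_isSafetyUtility (h : SingleUnsafe R od) {o₀ : O}
    (h₀ : o₀ ∈ safeOutcomes R od) : ∃ u, IsSafetyUtility R od u ∧ u (dirac o₀) = 0 := by
  have hR := h.independentWeakOrder
  obtain ⟨o₁, h₁, o₂, h₂, h21⟩ := h.exists_not_rel
  set d := (dirac o₁).weights - (dirac o₂).weights with hd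
  set b := (dirac o₀).weights - (dirac od).weights
  have hd_mem : d ∈ prefCone R := sub_mem_prefCone ((h.complete _ _).resolve_right h21)
  have hd_neg : -d ∉ prefCone R := by rwa [hd, neg_sub, hR.sub_mem_prefCone_iff]
  have hframe (x : Fin 2 → ℝ) :
      Fintype.linearCombination ℝ ![b, d] x ∈ prefCone R ↔ 0 ≤ toLex x :=
    linearCombination_mem_iff_toLex_nonneg hd_mem hd_neg
      (h.safety.sub_add_smul_sub_mem_prefCone hR h₀ h₁ h₂) x
  choose x hx_safe hx_od hx using h.exists_coord h₀ h₁ h₂ h21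
  obtain ⟨u, hlin, hlex, hu⟩ := hR.exists_isLexUtility_of_frame hframe hx
  have hx₀ : x o₀ = 0 := by
    have hmem := hx o₀
    rw [sub_self, zero_sub, ← map_neg] at hmem
    have hneg := (PointedCone.mem_lineal.1 hmem).2
    rw [← map_neg, neg_neg] at hneg
    exact eq_zero_of_toLex_nonneg ((hframe _).1 hneg) ((hframe _).1 hmem.1)
  exact ⟨u, ⟨hlin, hlex, (hu od).trans (hx_od od fun h' => h' ⟨h.complete.refl _,
    h.complete.refl _⟩), fun o ho => by rw [hu, hx_safe o ho]⟩, by rw [hu, hx₀]⟩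

lemma IsSafetyUtility.map_eq_of_notMem (h : IsSafetyUtility R od u) {o : O}
    (ho : o ∉ safeOutcomes R od) : u (dirac o) = ![-1, 0] :=
  (h.lex.indiff_iff.1 (not_not.1 ho)).trans h.map_od

lemma IsSafetyUtility.map_zero_eq_zero_or_neg_one (h : IsSafetyUtility R od u) (o : O) :
    u (dirac o) 0 = 0 ∨ u (dirac o) 0 = -1 := by
  by_cases ho : o ∈ safeOutcomes R od
  · exact .inl (h.map_safe o ho)
  · exact .inr (by simp [h.map_eq_of_notMem ho])

lemma IsSafetyUtility.map_eq_of_apply_zero_ne_zero (h : IsSafetyUtility R od u) {o : O}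
    (ho : u (dirac o) 0 ≠ 0) : u (dirac o) = ![-1, 0] :=
  h.map_eq_of_notMem (mt (h.map_safe o) ho)

lemma IsSafetyUtility.vectorSpan_eq_top (h : IsSafetyUtility R od u)
    (hne : ∃ o₁ ∈ safeOutcomes R od, ∃ o₂ ∈ safeOutcomes R od, u (dirac o₁) ≠ u (dirac o₂)) :
    vectorSpan ℝ (Set.range fun o => u (dirac o)) = ⊤ := by
  obtain ⟨o₁, h₁, o₂, h₂, hne⟩ := hne
  set s := u (dirac o₁) 1
  set g := s - u (dirac o₂) 1
  have hg0 : g ≠ 0 := fun hg0 => hne <| by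
    ext i
    fin_cases i
    exacts [(h.map_safe o₁ h₁).trans (h.map_safe o₂ h₂).symm, sub_eq_zero.1 hg0]
  have hmem (o o' : O) : u (dirac o) - u (dirac o') ∈
      vectorSpan ℝ (Set.range fun o => u (dirac o)) :=
    vsub_mem_vectorSpan ℝ ⟨o, rfl⟩ ⟨o', rfl⟩
  have hod0 : u (dirac od) 0 = -1 := congrFun h.map_od 0
  have hod1 : u (dirac od) 1 = 0 := congrFun h.map_od 1
  refine eq_top_iff.2 fun y _ => ?_
  have hy : y = y 0 • (u (dirac o₁) - u (dirac od)) +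
      ((y 1 - y 0 * s) / g) • (u (dirac o₁) - u (dirac o₂)) := by
    ext i
    fin_cases i
    · change y 0 = y 0 * (u (dirac o₁) 0 - u (dirac od) 0) +
        (y 1 - y 0 * s) / g * (u (dirac o₁) 0 - u (dirac o₂) 0)
      rw [h.map_safe o₁ h₁, h.map_safe o₂ h₂, hod0]
      ring
    · change y 1 = y 0 * (s - u (dirac od) 1) + (y 1 - y 0 * s) / g * g
      rw [hod1, div_mul_cancel₀ _ hg0]
      ring
  rw [hy]
  exact add_mem (Submodule.smul_mem _ _ (hmem _ _)) (Submodule.smul_mem _ _ (hmem _ _))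

lemma IsSafetyUtility.continuityOn (h : IsSafetyUtility R od u) :
    ContinuityOn R (lotteriesOn (safeOutcomes R od)) := by
  intro p hp q hq s hs hpq hqs
  have hzero {p : Lottery O} (hp : p ∈ lotteriesOn (safeOutcomes R od)) : u p 0 = 0 :=
    h.linear.apply_eq_of_mem_lotteriesOn h.map_safe hp
  rw [← h.lex, ge_iff_le, toLex_fin_two_le_iff, hzero hp, hzero hq] at hpq
  rw [← h.lex, ge_iff_le, toLex_fin_two_le_iff, hzero hq, hzero hs] at hqs
  simp only [lt_irrefl, true_and, false_or] at hpq hqs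
  have hmem : u q 1 ∈ segment ℝ (u s 1) (u p 1) := by
    rw [segment_eq_Icc (hqs.trans hpq)]
    exact ⟨hqs, hpq⟩
  obtain ⟨β, α, hβ, hα, hsum, heq⟩ := hmem
  obtain rfl : β = 1 - α := eq_sub_of_add_eq hsum
  have hαI : α ∈ Set.Icc (0 : ℝ) 1 := ⟨hα, sub_nonneg.1 hβ⟩
  refine ⟨α, hαI, h.lex.indiff_iff.2 ?_⟩
  rw [h.linear.map_mix]
  ext i
  fin_cases i
  · simp [hzero hp, hzero hq, hzero hs]
  · exact (add_comm _ _).trans heq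

lemma IsSafetyUtility.safetyFirst (h : IsSafetyUtility R od u) : SafetyFirst R od := by
  intro p hp q hq ε hε hpos
  rw [Strict, ← h.lex, ge_iff_le, toLex_fin_two_le_iff, h.linear.map_mix]
  simp [h.linear.apply_eq_of_mem_lotteriesOn h.map_safe hp,
    h.linear.apply_eq_of_mem_lotteriesOn h.map_safe hq, h.map_od, hpos.le, hpos.ne']

theorem IsSafetyUtility.singleUnsafe (h : IsSafetyUtility R od u)
    (hne : ∃ o₁ ∈ safeOutcomes R od, ∃ o₂ ∈ safeOutcomes R od, u (dirac o₁) ≠ u (dirac o₂)) :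
    SingleUnsafe R od where
  complete := (h.lex.independentWeakOrder h.linear).complete
  trans := (h.lex.independentWeakOrder h.linear).trans
  indep := (h.lex.independentWeakOrder h.linear).indep
  cont_safe := h.continuityOn
  safety := h.safetyFirst
  nontrivial := by simpa only [h.lex.indiff_iff] using hne

end SafetyUtility

section Recursion

variable {E : Type*} {R : Preference (List E)} {od : List E} {u : Lottery (List E) → Fin 2 → ℝ}
  {r γ : E → ℝ}

@[simp] lemma prepend_dirac (e : E) (τ : List E) : prepend e (dirac τ) = dirac (e :: τ) :=
  StdSimplex.map_single _ _

lemma IsLinearUtility.comp_prepend {d : ℕ} {u : Lottery (List E) → Fin d → ℝ}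
    (hu : IsLinearUtility u) (e : E) : IsLinearUtility fun p => u (prepend e p) := by
  intro p
  have hweights : (prepend e p).weights = p.weights.mapDomain (List.cons e) := rfl
  simp only [hu.eq_linearCombination (prepend e p), hweights, prepend_dirac,
    Finsupp.linearCombination_mapDomain]
  rfl

lemma Retains.isLexUtility_comp_prepend {d : ℕ} {u : Lottery (List E) → Fin d → ℝ} {e : E}
    (he : Retains R e) (hu : IsLexUtility R u) : IsLexUtility R fun p => u (prepend e p) :=
  fun p q => (hu _ _).trans (he p q)

lemma map_cons_eq_of_mem_terminalEvents {d : ℕ} {u : Lottery (List E) → Fin d → ℝ}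
    (hu : IsLexUtility R u) {e : E} (he : e ∈ terminalEvents R) (τ : List E) :
    u (dirac (e :: τ)) = u (dirac [e]) := by
  rw [← prepend_dirac, ← prepend_dirac, ← hu.indiff_iff]
  exact he _ _

lemma Retains.exists_map_cons_eq {e : E} (he : Retains R e) (hu : IsLexUtility R u)
    (hlin : IsLinearUtility u) (hspan : vectorSpan ℝ (Set.range fun o => u (dirac o)) = ⊤)
    (hnil : u (dirac []) = 0) :
    ∃ a c g : ℝ, 0 < a ∧ 0 < g ∧ ∀ τ, u (dirac (e :: τ)) =
      ![u (dirac [e]) 0 + a * u (dirac τ) 0,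
        u (dirac [e]) 1 + (c * u (dirac τ) 0 + g * u (dirac τ) 1)] := by
  obtain ⟨A, hA, hAu⟩ := hu.exists_preservesLex hlin hspan (he.isLexUtility_comp_prepend hu)
    (hlin.comp_prepend e)
  obtain ⟨a, c, g, ha, hg, rfl⟩ := hA.exists_eq_toLin'
  refine ⟨a, c, g, ha, hg, fun τ => ?_⟩
  have hdiff := hAu (dirac τ) (dirac [])
  rw [prepend_dirac, prepend_dirac, hnil, sub_zero, sub_eq_iff_eq_add'] at hdiff
  rw [hdiff]
  ext i
  fin_cases i <;> simp [dotProduct]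

theorem IsSafetyUtility.exists_map_cons_of_retains (h : IsSafetyUtility R od u)
    (hnil : u (dirac []) = 0)
    (hne : ∃ o₁ ∈ safeOutcomes R od, ∃ o₂ ∈ safeOutcomes R od, u (dirac o₁) ≠ u (dirac o₂))
    {e : E} (he : Retains R e) :
    ∃ g : ℝ, 0 < g ∧ ∀ τ, u (dirac (e :: τ)) = ![u (dirac τ) 0,
      (1 + u (dirac τ) 0) * u (dirac [e]) 1 + g * u (dirac τ) 1] := by
  obtain ⟨a, c, g, ha, hg, hcons⟩ :=
    he.exists_map_cons_eq h.lex h.linear (h.vectorSpan_eq_top hne) hnil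
  -- The first coordinate takes only the values `0` and `-1`, so at `od` it must drop from `0`
  -- to `-1`, which pins down `a` and the first coordinate of `u [e]`.
  have hod := hcons od
  simp only [h.map_od, Matrix.cons_val_zero, Matrix.cons_val_one, mul_zero, add_zero] at hod
  have hod0 : u (dirac (e :: od)) 0 = u (dirac [e]) 0 - a := by rw [hod]; simp [sub_eq_add_neg]
  obtain ⟨he0, rfl⟩ : u (dirac [e]) 0 = 0 ∧ a = 1 := by
    rcases h.map_zero_eq_zero_or_neg_one [e] with h1 | h1 <;>
      rcases h.map_zero_eq_zero_or_neg_one (e :: od) with h2 | h2 <;>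
      constructor <;> linarith
  have hod_eq : u (dirac (e :: od)) = ![-1, 0] :=
    h.map_eq_of_apply_zero_ne_zero (by rw [hod0, he0]; norm_num)
  have hc : c = u (dirac [e]) 1 := by
    have hod1 : u (dirac [e]) 1 + c * -1 = 0 := congrFun (hod.symm.trans hod_eq) 1
    linarith
  refine ⟨g, hg, fun τ => ?_⟩
  rw [hcons, he0, hc]
  congr 2 <;> ring

theorem IsSafetyUtility.exists_safeRecursion (h : IsSafetyUtility R od u)
    (hnil : u (dirac []) = 0)
    (hne : ∃ o₁ ∈ safeOutcomes R od, ∃ o₂ ∈ safeOutcomes R od, u (dirac o₁) ≠ u (dirac o₂))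
    (hm : Memorylessness R) : ∃ r γ : E → ℝ, (∀ e, 0 < γ e) ∧ SafeRecursion R od r γ u := by
  have hγ (e : E) : ∃ g : ℝ, 0 < g ∧ (Retains R e → ∀ τ, u (dirac (e :: τ)) = ![u (dirac τ) 0,
      (1 + u (dirac τ) 0) * u (dirac [e]) 1 + g * u (dirac τ) 1]) := by
    by_cases he : Retains R e
    · obtain ⟨g, hg, hcons⟩ := h.exists_map_cons_of_retains hnil hne he
      exact ⟨g, hg, fun _ => hcons⟩
    · exact ⟨1, one_pos, fun he' => absurd he' he⟩
  choose γ hγ_pos hγ using hγ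
  refine ⟨fun e => u (dirac [e]) 1, γ, hγ_pos,
    fun e τ => ⟨fun he => ?_, fun he => ?_, fun he => ?_⟩⟩
  · rw [map_cons_eq_of_mem_terminalEvents h.lex he.1]
    ext i
    fin_cases i
    exacts [h.map_safe [e] he.2, rfl]
  · have he_eq : u (dirac [e]) = ![-1, 0] := h.map_eq_of_notMem (not_not.2 he)
    have hterm : e ∈ terminalEvents R := (hm e).resolve_left fun hret => by
      have h0 := congrFun (hγ e hret []) 0
      simp [he_eq, hnil] at h0
    rw [map_cons_eq_of_mem_terminalEvents h.lex hterm, he_eq]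
  · exact hγ e ((hm e).resolve_right he.1) τ

lemma SafeRecursion.map_zero_eq_zero_or (hrec : SafeRecursion R od r γ u)
    (hnil : u (dirac []) = 0) (τ : List E) : u (dirac τ) 0 = 0 ∨ u (dirac τ) = ![-1, 0] := by
  induction τ with
  | nil => exact .inl (by rw [hnil]; rfl)
  | cons e τ ih =>
    obtain ⟨hterm, hbad, hret⟩ := hrec e τ
    by_cases hun : e ∈ unsafeEvents R od
    · exact .inr (hbad hun)
    by_cases hte : e ∈ terminalEvents R
    · exact .inl (by simp [hterm ⟨hte, hun⟩])
    rw [hret ⟨hte, hun⟩]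
    exact ih.imp id fun ih => by simp [ih]

theorem SafeRecursion.isSafetyUtility (hrec : SafeRecursion R od r γ u)
    (hlin : IsLinearUtility u) (hlex : IsLexUtility R u) (hnil : u (dirac []) = 0)
    (hod : u (dirac od) = ![-1, 0]) : IsSafetyUtility R od u where
  linear := hlin
  lex := hlex
  map_od := hod
  map_safe o ho := (hrec.map_zero_eq_zero_or hnil o).resolve_right fun h =>
    ho (hlex.indiff_iff.2 (h.trans hod.symm))

theorem SafeRecursion.memorylessness (hrec : SafeRecursion R od r γ u) (hlin : IsLinearUtility u)
    (hlex : IsLexUtility R u) (hγ : ∀ e, 0 < γ e) : Memorylessness R := by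
  intro e
  by_cases hun : e ∈ unsafeEvents R od
  · have hconst : (fun p => u (prepend e p)) = fun p => (0 : (Fin 2 → ℝ) →ₗ[ℝ] (Fin 2 → ℝ)) (u p)
        + ![-1, 0] :=
      (hlin.comp_prepend e).ext (hlin.affine 0 ![-1, 0]) fun τ => by
        simp [(hrec e τ).2.1 hun]
    refine .inr fun p q => hlex.indiff_iff.2 ?_
    exact (congrFun hconst p).trans (congrFun hconst q).symm
  by_cases hte : e ∈ terminalEvents R
  · exact .inr hte
  have haff : (fun p => u (prepend e p)) =
      fun p => Matrix.toLin' !![1, 0; r e, γ e] (u p) + ![0, r e] :=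
    (hlin.comp_prepend e).ext (hlin.affine _ _) fun τ => by
      rw [prepend_dirac, (hrec e τ).2.2 ⟨hte, hun⟩]
      ext i
      fin_cases i
      · simp [dotProduct]
      · simp only [Fin.mk_one, Matrix.cons_val_one, Matrix.cons_val_fin_one, Matrix.toLin'_apply,
          Matrix.cons_mulVec, dotProduct, Fin.sum_univ_two, Matrix.cons_val_zero, Pi.add_apply]
        ring
  refine .inl fun p q => ?_
  rw [isLexUtility_iff_sub_nonneg] at hlex
  rw [← hlex, ← hlex, congrFun haff p, congrFun haff q, add_sub_add_right_eq_sub, ← map_sub,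
    preservesLex_toLin' one_pos (hγ e)]

end Recursion

end LexEUT

end

theorem mainTheorem4 {E : Type*} (R : LexEUT.Preference (List E)) (od : List E)
    (hsafe : [] ∈ LexEUT.safeOutcomes R od) :
    (LexEUT.SingleUnsafe R od ∧ LexEUT.Memorylessness R) ↔
      ∃ (r : E → ℝ) (γ : E → ℝ) (u : LexEUT.Lottery (List E) → Fin 2 → ℝ),
        (∀ e, 0 < γ e) ∧
        LexEUT.IsLinearUtility u ∧
        LexEUT.IsLexUtility R u ∧
        u (LexEUT.dirac []) = 0 ∧
        u (LexEUT.dirac od) = ![-1, 0] ∧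
        (∃ o₁ ∈ LexEUT.safeOutcomes R od, ∃ o₂ ∈ LexEUT.safeOutcomes R od,
          u (LexEUT.dirac o₁) ≠ u (LexEUT.dirac o₂)) ∧
        LexEUT.SafeRecursion R od r γ u := by
  constructor
  · rintro ⟨h, hm⟩
    obtain ⟨u, hu, hnil⟩ := h.exists_isSafetyUtility hsafe
    have hne := h.nontrivial
    simp only [hu.lex.indiff_iff] at hne
    obtain ⟨r, γ, hγ, hrec⟩ := hu.exists_safeRecursion hnil hne hm
    exact ⟨r, γ, u, hγ, hu.linear, hu.lex, hnil, hu.map_od, hne, hrec⟩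
  · rintro ⟨r, γ, u, hγ, hlin, hlex, hnil, hod, hne, hrec⟩
    exact ⟨(hrec.isSafetyUtility hlin hlex hnil hod).singleUnsafe hne,
      hrec.memorylessness hlin hlex hγ⟩
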